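/- Let $(R,\mathfrak m,\kappa)$ be a Noetherian local domain of Krull dimension $n$ which is analytically irreducible, i.e. its $\mathfrak m$-adic completion is a domain. A real valuation on $R$ centered at $\mathfrak m$ is a function $v\colon R\to\mathbb R_{\ge 0}\cup\{+\infty\}$ with $v(-f)=v(f)$, $v(f+g)\ge\min\{v(f),v(g)\}$, $v(fg)=v(f)+v(g)$, $v(f)=+\infty$ if and only if $f=0$, and $v(f)>0$ if and only if $f\in\mathfrak m$. It is divisorial if the residue field of its valuation ring in $\mathrm{Frac}(R)$ has transcendence degree $n-1$ over $\kappa$; $\mathrm{DivVal}_{R,\mathfrak m}$ is the set of divisorial valuations. For an ideal $I$ put $v(I)=\min_{f\in I}v(f)$, and write $\overline I$ for the integral closure of $I$. An $\mathfrak m$-filtration is a family $\mathfrak a_\bullet=(\mathfrak a_\lambda)_{\lambda\in\mathbb R_{>0}}$ of $\mathfrak m$-primary ideals that is decreasing, left continuous ($\mathfrak a_{\lambda-\epsilon}=\mathfrak a_\lambda$ for $0<\epsilon\ll1$) and multiplicative ($\mathfrak a_\lambda\mathfrak a_\mu\subset\mathfrak a_{\lambda+\mu}$); put $v(\mathfrak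 a_\bullet)=\lim_{\lambda\to\infty}v(\mathfrak a_\lambda)/\lambda$. Its saturation $\widetilde{\mathfrak a}_\bullet$ is given by $$\widetilde{\mathfrak a}_\lambda=\{f\in\mathfrak m\mid v(f)\ge\lambda\, v(\mathfrak a_\bullet)\text{ for all }v\in\mathrm{DivVal}_{R,\mathfrak m}\},\qquad \lambda>0.$$ Let $\mathfrak a$ be an $\mathfrak m$-primary ideal of $R$, and let $\mathfrak a^\bullet=(\mathfrak a^{\lceil\lambda\rceil})_{\lambda>0}$ be the $\mathfrak a$-adic filtration. Let $\mathrm{RV}(\mathfrak a)$ be the set of Rees valuations of $\mathfrak a$: identifying a valuation with its positive real multiples, it is the smallest finite set $S\subset\mathrm{DivVal}_{R,\mathfrak m}$ such that $$\overline{\mathfrak a^m}=\{f\in R\mid v(f)\ge m\,v(\mathfrak a)\text{ for all }v\in S\}\quad\text{for all }m\in\mathbb Z_{>0},$$ that is, the intersection of all such finite sets. Then $$\widetilde{\mathfrak a^\bullet}=\bigcap_{v\in\mathrm{RV}(\mathfrak a)}\mathfrak a_\bullet\!\left(\frac{v}{v(\mathfrak a)}\right),$$ an equality of $\mathfrak m$-filtrations;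 that is, for every $\lambda>0$, $$\bigl(\widetilde{\mathfrak a^\bullet}\bigr)_\lambda=\{f\in\mathfrak m\mid v(f)\ge\lambda\,v(\mathfrak a)\text{ for all }v\in\mathrm{RV}(\mathfrak a)\}.$$ -/

import Mathlib

open IsLocalRing Filter
open scoped ENNReal NNReal

noncomputable section

universe u

/-- An ideal `I` of a local ring with maximal ideal `𝔪` is `𝔪`-primary. -/
def IsMPrimary {R : Type u} [CommRing R] [IsLocalRing R] (I : Ideal R) : Prop :=
  I.IsPrimary ∧ I.radical = maximalIdeal R

/-- An `𝔪`-filtration: a family `(𝔞_t)` of `𝔪`-primary ideals indexed by the real numbers `t > 0`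
which is decreasing, left continuous and multiplicative. (Only the values at `t > 0` matter.) -/
structure MFiltration (R : Type u) [CommRing R] [IsLocalRing R] where
  ideal : ℝ → Ideal R
  isMPrimary : ∀ t, 0 < t → IsMPrimary (ideal t)
  anti : ∀ s t, 0 < s → s < t → ideal t ≤ ideal s
  leftCts : ∀ t, 0 < t → ∃ δ, 0 < δ ∧ δ ≤ t ∧ ∀ ε, 0 < ε → ε < δ → ideal (t - ε) = ideal t
  mul_le : ∀ s t, 0 < s → 0 < t → ideal s * ideal t ≤ ideal (s + t)

theorem IsMPrimary.pow {R : Type u} [CommRing R] [IsLocalRing R] {I : Ideal R}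
    (hI : IsMPrimary I) {k : ℕ} (hk : k ≠ 0) : IsMPrimary (I ^ k) := by
  have h : (I ^ k).radical = maximalIdeal R := by rw [Ideal.radical_pow I hk, hI.2]
  refine ⟨Ideal.isPrimary_of_isMaximal_radical ?_, h⟩
  rw [h]; infer_instance

/-- The `𝔞`-adic filtration `𝔞^•`, with `𝔞_t = 𝔞 ^ ⌈t⌉`. -/
def adicFiltration {R : Type u} [CommRing R] [IsLocalRing R] (I : Ideal R) (hI : IsMPrimary I) :
    MFiltration R where
  ideal t := I ^ ⌈t⌉₊
  isMPrimary t ht := hI.pow (Nat.ceil_pos.2 ht).ne'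
  anti s t _ hst := Ideal.pow_le_pow_right (Nat.ceil_mono hst.le)
  leftCts t ht := by
    have h1 : 0 < ⌈t⌉₊ := Nat.ceil_pos.2 ht
    have h2 : ((⌈t⌉₊ : ℝ)) < t + 1 := Nat.ceil_lt_add_one ht.le
    have h3 : (1 : ℝ) ≤ ⌈t⌉₊ := by exact_mod_cast h1
    refine ⟨t - (⌈t⌉₊ - 1), by linarith, by linarith, fun ε h0 hε => ?_⟩
    have h4 : ⌈t - ε⌉₊ = ⌈t⌉₊ := by
      apply le_antisymm (Nat.ceil_mono (by linarith))
      have : ⌈t⌉₊ - 1 < ⌈t - ε⌉₊ := by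
        rw [Nat.lt_ceil, Nat.cast_sub h1]
        push_cast
        linarith
      omega
    simp only [h4]
  mul_le s t _ _ := by
    rw [← pow_add]
    exact Ideal.pow_le_pow_right (Nat.ceil_add_le s t)

/-- A real valuation on a local domain `R`, centered at the maximal ideal `𝔪`, written additively:
a multiplicative `𝔪`-norm `R → ℝ≥0 ∪ {+∞}`. -/
structure RealValuation (R : Type u) [CommRing R] [IsLocalRing R] where
  toFun : R → ℝ≥0∞
  map_neg : ∀ f, toFun (-f) = toFun f
  min_le_map_add : ∀ f g, min (toFun f) (toFun g) ≤ toFun (f + g)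
  map_mul : ∀ f g, toFun (f * g) = toFun f + toFun g
  eq_top_iff : ∀ f, toFun f = ⊤ ↔ f = 0
  pos_iff : ∀ f, 0 < toFun f ↔ f ∈ maximalIdeal R

namespace RealValuation

instance {R : Type u} [CommRing R] [IsLocalRing R] :
    CoeFun (RealValuation R) (fun _ => R → ℝ≥0∞) := ⟨toFun⟩

theorem map_zero {R : Type u} [CommRing R] [IsLocalRing R] (v : RealValuation R) : v 0 = ⊤ :=
  (v.eq_top_iff 0).2 rfl

theorem map_one {R : Type u} [CommRing R] [IsLocalRing R] (v : RealValuation R) : v 1 = 0 := by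
  by_contra h
  have h1 := (v.pos_iff 1).1 (pos_iff_ne_zero.2 h)
  exact (Ideal.ne_top_iff_one _).1 (maximalIdeal.isMaximal R).ne_top h1

theorem cancel {R : Type u} [CommRing R] [IsLocalRing R] (v : RealValuation R) {f g b : R}
    (hb : b ≠ 0) (h : v (b * f) ≤ v (b * g)) : v f ≤ v g := by
  rw [v.map_mul, v.map_mul] at h
  exact (ENNReal.add_le_add_iff_left (fun h' => hb ((v.eq_top_iff b).1 h'))).1 h

/-- The valuation ring `{f / g | g ≠ 0, v f ≥ v g}` of `v` in the fraction field of `R`. -/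
def valuationRing {R : Type u} [CommRing R] [IsDomain R] [IsLocalRing R] (v : RealValuation R) :
    ValuationSubring (FractionRing R) where
  carrier := {x | ∃ f g : R, g ≠ 0 ∧
    x = algebraMap R (FractionRing R) f / algebraMap R (FractionRing R) g ∧ v g ≤ v f}
  mul_mem' := by
    rintro _ _ ⟨f, g, hg, rfl, h⟩ ⟨f', g', hg', rfl, h'⟩
    refine ⟨f * f', g * g', mul_ne_zero hg hg', ?_, ?_⟩
    · rw [_root_.map_mul, _root_.map_mul, div_mul_div_comm]
    · rw [v.map_mul, v.map_mul]; exact add_le_add h h'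
  one_mem' := ⟨1, 1, one_ne_zero, by simp, le_rfl⟩
  add_mem' := by
    rintro _ _ ⟨f, g, hg, rfl, h⟩ ⟨f', g', hg', rfl, h'⟩
    have i : ∀ {x : R}, x ≠ 0 → algebraMap R (FractionRing R) x ≠ 0 := fun hx =>
      (map_ne_zero_iff _ (IsFractionRing.injective R (FractionRing R))).2 hx
    refine ⟨f * g' + g * f', g * g', mul_ne_zero hg hg', ?_, ?_⟩
    · rw [div_add_div _ _ (i hg) (i hg')]; simp only [_root_.map_mul, _root_.map_add]
    · refine le_trans ?_ (v.min_le_map_add _ _)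
      rw [v.map_mul, v.map_mul, v.map_mul]
      exact le_min (by gcongr) (by gcongr)
  zero_mem' := ⟨0, 1, one_ne_zero, by simp, by rw [v.map_zero]; exact le_top⟩
  neg_mem' := by
    rintro _ ⟨f, g, hg, rfl, h⟩
    exact ⟨-f, g, hg, by rw [_root_.map_neg, neg_div], by rwa [v.map_neg]⟩
  mem_or_inv_mem' := by
    intro x
    obtain ⟨f, g, hg, rfl⟩ := IsFractionRing.div_surjective (A := R) x
    have hg0 : g ≠ 0 := nonZeroDivisors.ne_zero hg
    by_cases hf : f = 0
    · exact Or.inl ⟨f, g, hg0, rfl, by rw [hf, v.map_zero]; exact le_top⟩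
    · rcases le_total (v g) (v f) with h | h
      · exact Or.inl ⟨f, g, hg0, rfl, h⟩
      · exact Or.inr ⟨g, f, hf, by rw [inv_div], h⟩

theorem algebraMap_mem {R : Type u} [CommRing R] [IsDomain R] [IsLocalRing R]
    (v : RealValuation R) (f : R) : algebraMap R (FractionRing R) f ∈ v.valuationRing :=
  ⟨f, 1, one_ne_zero, by simp, by rw [v.map_one]; exact zero_le⟩

/-- The inclusion of `R` into the valuation ring of `v`. -/
def toValuationRing {R : Type u} [CommRing R] [IsDomain R] [IsLocalRing R]
    (v : RealValuation R) : R →+* v.valuationRing :=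
  (algebraMap R (FractionRing R)).codRestrict v.valuationRing v.algebraMap_mem

instance {R : Type u} [CommRing R] [IsDomain R] [IsLocalRing R] (v : RealValuation R) :
    IsLocalHom v.toValuationRing where
  map_nonunit := by
    intro r hr
    obtain ⟨⟨y, f, g, hg, hy, h⟩, hz⟩ := hr.exists_right_inv
    have h1 : algebraMap R (FractionRing R) r * y = 1 := congrArg Subtype.val hz
    have hg' : algebraMap R (FractionRing R) g ≠ 0 :=
      (map_ne_zero_iff _ (IsFractionRing.injective R (FractionRing R))).2 hg
    have h2 : r * f = g := by
      apply IsFractionRing.injective R (FractionRing R)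
      rw [hy] at h1
      rw [_root_.map_mul]
      field_simp at h1
      exact h1
    have h3 : v r = 0 := by
      have h4 : v (f * r) ≤ v (f * 1) := by rwa [mul_comm, h2, mul_one]
      have hf : f ≠ 0 := by rintro rfl; exact hg (by rw [← h2, mul_zero])
      have := v.cancel hf h4
      rwa [v.map_one, nonpos_iff_eq_zero] at this
    by_contra hu
    exact ((v.pos_iff r).2 ((mem_maximalIdeal r).2 hu)).ne' h3

/-- The residue field `κ_v` of (the valuation ring of) `v`. -/
abbrev residueField {R : Type u} [CommRing R] [IsDomain R] [IsLocalRing R]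
    (v : RealValuation R) : Type u := ResidueField v.valuationRing

/-- `κ_v` is an extension of the residue field `κ` of `R`. -/
instance algebraResidueField {R : Type u} [CommRing R] [IsDomain R] [IsLocalRing R]
    (v : RealValuation R) : Algebra (ResidueField R) v.residueField :=
  (ResidueField.map v.toValuationRing).toAlgebra

/-- `v` is divisorial: `tr.deg_κ (κ_v) = n - 1`, where `n` is the Krull dimension of `R`
(written without subtraction). -/
def IsDivisorial {R : Type u} [CommRing R] [IsDomain R] [IsLocalRing R]
    (v : RealValuation R) : Prop :=
  ∃ d : ℕ, Algebra.trdeg (ResidueField R) v.residueField = d ∧ ringKrullDim R = d + 1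

/-- `v(I) = min {v(f) | f ∈ I}` for an ideal `I`. -/
def onIdeal {R : Type u} [CommRing R] [IsLocalRing R] (v : RealValuation R) (I : Ideal R) : ℝ≥0∞ :=
  ⨅ f ∈ I, v f

/-- `v(𝔞_•) = lim_{t → ∞} v(𝔞_t) / t` for an `𝔪`-filtration `𝔞_•`. (The limit always exists, by
subadditivity of `t ↦ v(𝔞_t)`.) -/
def onFiltration {R : Type u} [CommRing R] [IsLocalRing R] (v : RealValuation R)
    (𝔞 : MFiltration R) : ℝ≥0∞ :=
  limUnder atTop (fun t : ℝ => v.onIdeal (𝔞.ideal t) / ENNReal.ofReal t)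

/-- The ideal `𝔞_t(v / c) = {f ∈ R | v(f) / c ≥ t}` of the rescaled valuation `v / c`
(the condition is written as `t * c ≤ v(f)`, which is the same for `0 < c < ∞`). -/
def scaledIdeal {R : Type u} [CommRing R] [IsLocalRing R] (v : RealValuation R) (c : ℝ≥0∞)
    (t : ℝ) : Ideal R where
  carrier := {f | ENNReal.ofReal t * c ≤ v f}
  add_mem' := fun hf hg => (le_min hf hg).trans (v.min_le_map_add _ _)
  zero_mem' := by
    simp only [Set.mem_ofPred_eq, v.map_zero]
    exact le_top
  smul_mem' := by
    intro r f hf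
    simp only [Set.mem_ofPred_eq, smul_eq_mul, v.map_mul] at hf ⊢
    exact hf.trans le_add_self

/-- `v` and `w` agree up to scaling: `w = c * v` for some real number `c > 0`. -/
def IsEquiv {R : Type u} [CommRing R] [IsLocalRing R] (v w : RealValuation R) : Prop :=
  ∃ c : ℝ≥0, c ≠ 0 ∧ ∀ f, w f = c * v f

end RealValuation

/-- The saturation of an `𝔪`-filtration `𝔞_•`: its ideal at `t` consists of the `f ∈ 𝔪` with
`v(f) ≥ t * v(𝔞_•)` for all divisorial valuations `v`. -/
def MFiltration.saturation {R : Type u} [CommRing R] [IsDomain R] [IsLocalRing R]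
    (𝔞 : MFiltration R) (t : ℝ) : Ideal R where
  carrier := {f | f ∈ maximalIdeal R ∧
    ∀ v : RealValuation R, v.IsDivisorial → ENNReal.ofReal t * v.onFiltration 𝔞 ≤ v f}
  add_mem' := fun hf hg => ⟨Ideal.add_mem _ hf.1 hg.1, fun v hv =>
    (le_min (hf.2 v hv) (hg.2 v hv)).trans (v.min_le_map_add _ _)⟩
  zero_mem' := ⟨Ideal.zero_mem _, fun v _ => by rw [v.map_zero]; exact le_top⟩
  smul_mem' := by
    rintro r f ⟨hf, h⟩
    refine ⟨Ideal.mul_mem_left _ r hf, fun v hv => ?_⟩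
    rw [smul_eq_mul, v.map_mul]
    exact (h v hv).trans le_add_self

/-- `f` lies in the integral closure of the ideal `I`: there are `k ≥ 1` and `c_i ∈ I ^ i` with
`f ^ k + c_1 f ^ (k - 1) + ⋯ + c_k = 0`. -/
def IsIntegralOverIdeal {R : Type u} [CommRing R] (I : Ideal R) (f : R) : Prop :=
  ∃ k : ℕ, 1 ≤ k ∧ ∃ c : ℕ → R, (∀ i ∈ Finset.Icc 1 k, c i ∈ I ^ i) ∧
    f ^ k + ∑ i ∈ Finset.Icc 1 k, c i * f ^ (k - i) = 0

/-- `S` is a set of divisorial valuations which computes the integral closures of all powers of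
`I`: for every integer `m ≥ 1`, the integral closure of `I ^ m` is
`{f | v(f) ≥ m * v(I) for all v ∈ S}`. -/
def ComputesIntegralClosures {R : Type u} [CommRing R] [IsDomain R] [IsLocalRing R]
    (I : Ideal R) (S : Set (RealValuation R)) : Prop :=
  (∀ v ∈ S, v.IsDivisorial) ∧
    ∀ m : ℕ, 1 ≤ m → ∀ f : R, IsIntegralOverIdeal (I ^ m) f ↔ ∀ v ∈ S, m * v.onIdeal I ≤ v f

/-- The Rees valuations of `I`, where a valuation is identified with its positive multiples: the
smallest finite set of divisorial valuations that computes the integral closures of all powers of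
`I`. So a divisorial valuation is a Rees valuation if, up to scaling, it belongs to every such
finite set. As a set of functions, `reesValuations I` is closed under scaling. -/
def reesValuations {R : Type u} [CommRing R] [IsDomain R] [IsLocalRing R]
    (I : Ideal R) : Set (RealValuation R) :=
  {v | v.IsDivisorial ∧ ∀ S : Set (RealValuation R), S.Finite → ComputesIntegralClosures I S →
    ∃ w ∈ S, w.IsEquiv v}

end

open Topology

/-! Since `v(𝔞^m) = m v(𝔞)`, the saturation at `t` is cut out by `v(f) ≥ t v(𝔞)` over all divisorial
`v`, so the point is that the Rees valuations already enforce these bounds. A bound on a computing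
set passes to every divisorial valuation by approximating from below with rationals `p/q`: `f^q` is
then integral over `𝔞^p`, which bounds every centered valuation (`le_normalized`). Every finite
computing set contains a minimal one, and a minimal one consists of Rees valuations because it
embeds, up to scaling, in any other (`exists_isEquiv`). Rees's existence theorem is not invoked: a
divisorial valuation that is not Rees is, by definition, missed by some finite computing set. -/

namespace RealValuation

/-! ### Values on ideals, powers and integral closures. -/

section LocalRing

variable {R : Type*} [CommRing R] [IsLocalRing R] (v : RealValuation R)

theorem map_pow (f : R) (n : ℕ) : v (f ^ n) = n * v f := by
  induction n with
  | zero => simp [v.map_one]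
  | succ n ih => rw [pow_succ, v.map_mul, ih]; push_cast; ring

theorem ne_top {f : R} (hf : f ≠ 0) : v f ≠ ⊤ := fun h => hf ((v.eq_top_iff f).1 h)

theorem lt_map_sum {ι : Type*} (s : Finset ι) (F : ι → R) {c : ℝ≥0∞} (hc : c < ⊤)
    (h : ∀ i ∈ s, c < v (F i)) : c < v (∑ i ∈ s, F i) := by
  classical
  induction s using Finset.induction_on with
  | empty => simpa [v.map_zero] using hc
  | insert a s ha ih =>
    rw [Finset.sum_insert ha]
    exact (lt_min (h _ (Finset.mem_insert_self _ _))
      (ih fun i hi => h i (Finset.mem_insert_of_mem hi))).trans_le (v.min_le_map_add _ _)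

theorem onIdeal_le {I : Ideal R} {f : R} (hf : f ∈ I) : v.onIdeal I ≤ v f :=
  iInf₂_le f hf

theorem mem_scaledIdeal {c : ℝ≥0∞} {t : ℝ} {f : R} :
    f ∈ v.scaledIdeal c t ↔ ENNReal.ofReal t * c ≤ v f := Iff.rfl

theorem le_onIdeal_iff {I : Ideal R} {c : ℝ≥0∞} : c ≤ v.onIdeal I ↔ I ≤ v.scaledIdeal c 1 := by
  simp [onIdeal, SetLike.le_def, mem_scaledIdeal]

theorem onIdeal_pow (I : Ideal R) (m : ℕ) : v.onIdeal (I ^ m) = m * v.onIdeal I := by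
  apply le_antisymm
  · rcases Nat.eq_zero_or_pos m with rfl | hm
    · have h : (1 : R) ∈ I ^ 0 := by rw [pow_zero, Ideal.one_eq_top]; trivial
      exact (v.onIdeal_le h).trans (by rw [v.map_one]; exact zero_le)
    · unfold onIdeal
      rw [ENNReal.mul_iInf_of_ne (by exact_mod_cast hm.ne') (by simp)]
      refine le_iInf fun f => ?_
      rw [ENNReal.mul_iInf_of_ne (by exact_mod_cast hm.ne') (by simp)]
      refine le_iInf fun hf => ?_
      rw [← v.map_pow]
      exact v.onIdeal_le (Ideal.pow_mem_pow hf m)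
  · induction m with
    | zero => simp
    | succ m ih =>
      rw [le_onIdeal_iff, pow_succ, Ideal.mul_le]
      intro r hr s hs
      rw [mem_scaledIdeal, v.map_mul, ENNReal.ofReal_one, one_mul]
      push_cast
      rw [add_mul, one_mul]
      exact add_le_add (ih.trans (v.onIdeal_le hr)) (v.onIdeal_le hs)

/-- The quotient is `(⌈t⌉ / t) * v(I)`, and `⌈t⌉ / t → 1`; as this limit is nonzero, `v(I) = ⊤` is
allowed. -/
theorem onFiltration_adicFiltration {I : Ideal R} (hI : IsMPrimary I) :
    v.onFiltration (adicFiltration I hI) = v.onIdeal I := by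
  apply Tendsto.limUnder_eq
  have h1 : Tendsto (fun t : ℝ => ENNReal.ofReal (⌈t⌉₊ / t)) atTop (𝓝 1) := by
    simpa using ENNReal.tendsto_ofReal (tendsto_nat_ceil_div_atTop (R := ℝ))
  have h2 := ENNReal.Tendsto.mul_const (b := v.onIdeal I) h1 (Or.inl one_ne_zero)
  rw [one_mul] at h2
  refine h2.congr' ?_
  filter_upwards [eventually_gt_atTop 0] with t ht
  change _ = v.onIdeal (I ^ ⌈t⌉₊) / _
  rw [onIdeal_pow, ENNReal.ofReal_div_of_pos ht, ENNReal.ofReal_natCast, div_eq_mul_inv,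
    div_eq_mul_inv, mul_right_comm]

/-- Every valuation centered at `𝔪` is bounded below on the integral closure of a power. -/
theorem le_of_isIntegralOverIdeal {I : Ideal R} {m : ℕ} {f : R}
    (hf : IsIntegralOverIdeal (I ^ m) f) : m * v.onIdeal I ≤ v f := by
  obtain ⟨k, -, c, hc, h⟩ := hf
  by_contra! hlt
  have hfin : v f ≠ ⊤ := hlt.ne_top
  -- If `v f < m v(I)`, every `c_i f^(k-i)` has value above `k v(f)`, yet these terms sum to `-f^k`.
  have hk : v (f ^ k) < v (∑ i ∈ Finset.Icc 1 k, c i * f ^ (k - i)) := by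
    refine v.lt_map_sum _ _ ?_ fun i hi => ?_
    · rw [v.map_pow]; exact ENNReal.mul_lt_top (by simp) hfin.lt_top
    · obtain ⟨h1, h2⟩ := Finset.mem_Icc.1 hi
      have h3 : (i : ℝ≥0∞) * v f < v (c i) := by
        have h4 := v.onIdeal_le (hc i hi)
        rw [onIdeal_pow, onIdeal_pow] at h4
        refine lt_of_lt_of_le ?_ h4
        exact ENNReal.mul_lt_mul_right (by exact_mod_cast (by omega : i ≠ 0)) (by simp) hlt
      rw [v.map_mul, v.map_pow, v.map_pow]
      calc (k : ℝ≥0∞) * v f = i * v f + (k - i : ℕ) * v f := by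
            rw [← add_mul, ← Nat.cast_add, Nat.add_sub_cancel' h2]
        _ < _ := ENNReal.add_lt_add_right (ENNReal.mul_ne_top (by simp) hfin) h3
  rw [← eq_neg_iff_add_eq_zero] at h
  rw [h, v.map_neg] at hk
  exact hk.false

/-- By finite generation, the infimum is bounded below by a minimum of finitely many positive
values. -/
theorem onIdeal_pos [IsNoetherianRing R] {I : Ideal R} (hI : I ≤ maximalIdeal R) :
    0 < v.onIdeal I := by
  obtain ⟨s, rfl⟩ := (isNoetherianRing_iff_ideal_fg R).1 inferInstance I
  have hs : 0 < s.inf v := by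
    rw [Finset.lt_inf_iff (by simp)]
    exact fun f hf => (v.pos_iff f).2 (hI (Ideal.subset_span hf))
  refine hs.trans_le (v.le_onIdeal_iff.2 (Ideal.span_le.2 fun f hf => ?_))
  change ENNReal.ofReal 1 * s.inf v ≤ v f
  simpa using Finset.inf_le (f := v) hf

theorem onIdeal_ne_zero [IsNoetherianRing R] {I : Ideal R} (hI : IsMPrimary I) :
    v.onIdeal I ≠ 0 :=
  (v.onIdeal_pos (hI.2 ▸ Ideal.le_radical)).ne'

/-- The value of `f` under the multiple of `v` with value `1` on `I`, as a real number. -/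
noncomputable def normalized (I : Ideal R) (f : R) : ℝ := (v f / v.onIdeal I).toReal

variable {v} {I : Ideal R}

theorem normalized_nonneg (f : R) : 0 ≤ v.normalized I f := ENNReal.toReal_nonneg

/-- At `f = 0` the quantity `normalized` is the default `0` instead of `⊤`, hence the condition `f ≠
0` from here on. -/
theorem div_ne_top (h0 : v.onIdeal I ≠ 0) {f : R} (hf : f ≠ 0) : v f / v.onIdeal I ≠ ⊤ :=
  ENNReal.div_ne_top (v.ne_top hf) h0

theorem normalized_mul (h0 : v.onIdeal I ≠ 0) {f g : R} (hf : f ≠ 0) (hg : g ≠ 0) :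
    v.normalized I (f * g) = v.normalized I f + v.normalized I g := by
  unfold normalized
  rw [v.map_mul, ENNReal.add_div, ENNReal.toReal_add (div_ne_top h0 hf) (div_ne_top h0 hg)]

theorem normalized_pow (f : R) (n : ℕ) :
    v.normalized I (f ^ n) = n * v.normalized I f := by
  unfold normalized
  rw [v.map_pow, mul_div_assoc, ENNReal.toReal_mul, ENNReal.toReal_natCast]

theorem normalized_prod [IsDomain R] (h0 : v.onIdeal I ≠ 0) {ι : Type*} (s : Finset ι) (F : ι → R)
    (hF : ∀ i ∈ s, F i ≠ 0) : v.normalized I (∏ i ∈ s, F i) = ∑ i ∈ s, v.normalized I (F i) := by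
  classical
  induction s using Finset.induction_on with
  | empty => simp [normalized, v.map_one]
  | insert a s ha ih =>
    have hs : ∀ i ∈ s, F i ≠ 0 := fun i hi => hF i (Finset.mem_insert_of_mem hi)
    rw [Finset.prod_insert ha, Finset.sum_insert ha,
      normalized_mul h0 (hF a (Finset.mem_insert_self _ _)) (Finset.prod_ne_zero_iff.2 hs), ih hs]

theorem le_normalized_iff (h0 : v.onIdeal I ≠ 0) (ht : v.onIdeal I ≠ ⊤) {f : R} (hf : f ≠ 0)
    (s : ℝ) : s ≤ v.normalized I f ↔ ENNReal.ofReal s * v.onIdeal I ≤ v f := by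
  rw [normalized, ← ENNReal.ofReal_le_iff_le_toReal (div_ne_top h0 hf),
    ENNReal.le_div_iff_mul_le (Or.inl h0) (Or.inl ht)]

theorem natCast_le_normalized_iff (h0 : v.onIdeal I ≠ 0) (ht : v.onIdeal I ≠ ⊤) {f : R}
    (hf : f ≠ 0) (m : ℕ) : m ≤ v.normalized I f ↔ m * v.onIdeal I ≤ v f := by
  rw [le_normalized_iff h0 ht hf, ENNReal.ofReal_natCast]

theorem isEquiv_of_normalized_eq {w : RealValuation R} (hv0 : v.onIdeal I ≠ 0)
    (hvt : v.onIdeal I ≠ ⊤) (hw0 : w.onIdeal I ≠ 0) (hwt : w.onIdeal I ≠ ⊤)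
    (h : ∀ g, g ≠ 0 → w.normalized I g = v.normalized I g) : w.IsEquiv v := by
  have hr : v.onIdeal I / w.onIdeal I ≠ ⊤ := ENNReal.div_ne_top hvt hw0
  have hr0 : v.onIdeal I / w.onIdeal I ≠ 0 := ENNReal.div_ne_zero.2 ⟨hv0, hwt⟩
  refine ⟨(v.onIdeal I / w.onIdeal I).toNNReal, ?_, fun g => ?_⟩
  · exact (ENNReal.toNNReal_pos hr0 hr).ne'
  rw [ENNReal.coe_toNNReal hr]
  by_cases hg : g = 0
  · rw [hg, v.map_zero, w.map_zero, ENNReal.mul_top hr0]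
  have h1 := (ENNReal.toReal_eq_toReal_iff' (div_ne_top hw0 hg) (div_ne_top hv0 hg)).1 (h g hg)
  calc v g = v.onIdeal I * (v g / v.onIdeal I) := (ENNReal.mul_div_cancel hv0 hvt).symm
    _ = v.onIdeal I * (w g / w.onIdeal I) := by rw [h1]
    _ = v.onIdeal I / w.onIdeal I * w g := by
      rw [div_eq_mul_inv, div_eq_mul_inv, mul_assoc, mul_comm (w g)]

end LocalRing

section LocalDomain

variable {R : Type*} [CommRing R] [IsDomain R] [IsLocalRing R] {v : RealValuation R} {I : Ideal R}

/-- Divisoriality forces dimension `d + 1 ≥ 1`, so `R` is not a field and an `𝔪`-primary ideal is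
nonzero. -/
theorem IsDivisorial.onIdeal_ne_top (hv : v.IsDivisorial) (hI : IsMPrimary I) :
    v.onIdeal I ≠ ⊤ := by
  obtain ⟨d, -, hd⟩ := hv
  have hne : I ≠ ⊥ := by
    rintro rfl
    have h1 : maximalIdeal R = ⊥ := by
      rw [← hI.2]; exact (Ideal.isRadical_iff_quotient_reduced _).2 inferInstance |>.radical
    rw [ringKrullDim_eq_zero_of_isField (isField_iff_maximalIdeal_eq.2 h1)] at hd
    have hd' : (0 : ℕ) = d + 1 := by exact_mod_cast hd
    omega
  obtain ⟨f, hf, hf0⟩ := Submodule.exists_mem_ne_zero_of_ne_bot hne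
  exact ((v.onIdeal_le hf).trans_lt (v.ne_top hf0).lt_top).ne

end LocalDomain

end RealValuation

/-! ### Comparison of finite computing sets. -/

section ReesValuations

open RealValuation

variable {R : Type*} [CommRing R] [IsDomain R] [IsLocalRing R] [IsNoetherianRing R] {I : Ideal R}
  {S T : Set (RealValuation R)}

namespace ComputesIntegralClosures

/-- A lower bound on a set computing the integral closures of the powers of `I` holds for all
divisorial valuations. -/
theorem le_normalized (hS : ComputesIntegralClosures I S) (hI : IsMPrimary I)
    {w : RealValuation R} (hw : w.IsDivisorial) {f : R} (hf : f ≠ 0) {s : ℝ}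
    (h : ∀ v ∈ S, s ≤ v.normalized I f) : s ≤ w.normalized I f := by
  by_contra! hlt
  obtain ⟨q, hq1, hq2⟩ := exists_rat_btwn hlt
  have hq0 : 0 < q := by exact_mod_cast (w.normalized_nonneg f).trans_lt hq1
  have hden : (0 : ℝ) < q.den := by exact_mod_cast q.den_pos
  obtain ⟨p, hp⟩ := Int.eq_ofNat_of_zero_le (Rat.num_pos.2 hq0).le
  have hp1 : 1 ≤ p := by have := Rat.num_pos.2 hq0; omega
  have hqp : (q : ℝ) * q.den = p := by
    have : q * q.den = (p : ℚ) := by rw [Rat.mul_den_eq_num, hp]; simp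
    exact_mod_cast this
  -- With `q = p / q.den < s`, each member of `S` gives `f ^ q.den` normalized value at least `p`.
  have hint : IsIntegralOverIdeal (I ^ p) (f ^ q.den) := by
    rw [hS.2 p hp1]
    intro v hv
    rw [← natCast_le_normalized_iff (v.onIdeal_ne_zero hI) ((hS.1 v hv).onIdeal_ne_top hI)
      (pow_ne_zero _ hf), normalized_pow, ← hqp, mul_comm]
    gcongr
    exact hq2.le.trans (h v hv)
  have h1 := w.le_of_isIntegralOverIdeal hint
  rw [← natCast_le_normalized_iff (w.onIdeal_ne_zero hI) (hw.onIdeal_ne_top hI)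
    (pow_ne_zero _ hf), normalized_pow, ← hqp, mul_comm] at h1
  exact absurd (le_of_mul_le_mul_left h1 hden) (not_le.2 hq1)

/-- In a finite set computing the integral closures, some valuation is at most any given
divisorial one at a given element. -/
theorem exists_normalized_le (hS : ComputesIntegralClosures I S) (hfin : S.Finite)
    (hI : IsMPrimary I) {v : RealValuation R} (hv : v.IsDivisorial) {f : R} (hf : f ≠ 0) :
    ∃ w ∈ S, w.normalized I f ≤ v.normalized I f := by
  by_contra! h
  -- Finiteness leaves a uniform gap above `v.normalized I f`.
  have h1 : ∃ s, v.normalized I f < s ∧ ∀ w ∈ S, s ≤ w.normalized I f := by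
    have h2 : ∀ᶠ s in 𝓝[>] v.normalized I f, ∀ w ∈ S, s ≤ w.normalized I f :=
      (eventually_all_finite hfin).2 fun w hw =>
        eventually_nhdsWithin_of_eventually_nhds
          ((eventually_lt_nhds (h w hw)).mono fun _ => le_of_lt)
    obtain ⟨s, hs⟩ := (h2.and self_mem_nhdsWithin).exists
    exact ⟨s, hs.2, hs.1⟩
  obtain ⟨s, hs1, hs2⟩ := h1
  exact absurd (hS.le_normalized hI hv hf hs2) (not_le.2 hs1)

/-- A member of a minimal computing set is, at some element, strictly smaller than all other
members. -/
theorem exists_normalized_lt (hS : ComputesIntegralClosures I S) (hI : IsMPrimary I)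
    {v : RealValuation R} (hv : v ∈ S) (hmin : ¬ ComputesIntegralClosures I (S \ {v})) :
    ∃ f, f ≠ 0 ∧ ∀ u ∈ S, u ≠ v → v.normalized I f < u.normalized I f := by
  by_contra! hcon
  refine hmin ⟨fun u hu => hS.1 u hu.1, fun m hm f =>
    ⟨fun h u _ => u.le_of_isIntegralOverIdeal h, fun h => (hS.2 m hm f).2 fun u hu => ?_⟩⟩
  -- The condition imposed by `v` at `f` follows from that of some other member, so `v` could be
  -- dropped.
  by_cases huv : u = v
  · subst huv
    by_cases hf : f = 0
    · rw [hf, u.map_zero]; exact le_top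
    obtain ⟨u', hu', hne, hle⟩ := hcon f hf
    have h0 := h u' ⟨hu', hne⟩
    rw [← natCast_le_normalized_iff (onIdeal_ne_zero _ hI) ((hS.1 _ hu').onIdeal_ne_top hI)
      hf] at h0
    rw [← natCast_le_normalized_iff (onIdeal_ne_zero _ hI) ((hS.1 _ hv).onIdeal_ne_top hI) hf]
    exact h0.trans hle
  · exact h u ⟨hu, huv⟩

/-- A valuation which is a minimum of finitely many valuations is one of them. -/
theorem exists_isEquiv_of_forall_exists (hI : IsMPrimary I) (hfin : T.Finite)
    (hT : ∀ w ∈ T, w.IsDivisorial) {v : RealValuation R} (hv : v.IsDivisorial)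
    (hle : ∀ w ∈ T, ∀ g, g ≠ 0 → v.normalized I g ≤ w.normalized I g)
    (heq : ∀ g, g ≠ 0 → ∃ w ∈ T, w.normalized I g = v.normalized I g) :
    ∃ w ∈ T, w.IsEquiv v := by
  classical
  by_contra! hcon
  have hex : ∀ w, ∃ g, g ≠ 0 ∧ (w ∈ T → v.normalized I g < w.normalized I g) := by
    intro w
    by_cases hw : w ∈ T
    · have h1 := mt (isEquiv_of_normalized_eq (v.onIdeal_ne_zero hI) (hv.onIdeal_ne_top hI)
        (w.onIdeal_ne_zero hI) ((hT w hw).onIdeal_ne_top hI)) (hcon w hw)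
      push Not at h1
      obtain ⟨g, hg, hne⟩ := h1
      exact ⟨g, hg, fun _ => lt_of_le_of_ne (hle w hw g hg) hne.symm⟩
    · exact ⟨1, one_ne_zero, fun h => absurd h hw⟩
  choose g hg0 hg using hex
  -- At the product of the witnesses every `w ∈ T` strictly exceeds `v`, since its own factor
  -- contributes a strict inequality.
  obtain ⟨w, hw, h⟩ := heq (∏ u ∈ hfin.toFinset, g u)
    (Finset.prod_ne_zero_iff.2 fun u _ => hg0 u)
  rw [normalized_prod (w.onIdeal_ne_zero hI) _ _ fun u _ => hg0 u,
    normalized_prod (v.onIdeal_ne_zero hI) _ _ fun u _ => hg0 u] at h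
  exact (Finset.sum_lt_sum (fun u _ => hle w hw (g u) (hg0 u))
    ⟨w, hfin.mem_toFinset.2 hw, hg w hw⟩).ne' h

/-- A minimal finite computing set is contained, up to scaling, in every finite computing set. -/
theorem exists_isEquiv (hS : ComputesIntegralClosures I S) (hSfin : S.Finite)
    (hT : ComputesIntegralClosures I T) (hTfin : T.Finite) (hI : IsMPrimary I)
    {v : RealValuation R} (hv : v ∈ S) (hmin : ¬ ComputesIntegralClosures I (S \ {v})) :
    ∃ w ∈ T, w.IsEquiv v := by
  have hvd := hS.1 v hv
  obtain ⟨f, hf, hlt⟩ := hS.exists_normalized_lt hI hv hmin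
  have hexp : ∀ (u : RealValuation R) (g : R), g ≠ 0 → ∀ k : ℕ,
      u.normalized I (g * f ^ k) = u.normalized I g + k * u.normalized I f := fun u g hg k => by
    rw [normalized_mul (u.onIdeal_ne_zero hI) hg (pow_ne_zero _ hf), normalized_pow]
  have hfle : ∀ w ∈ T, v.normalized I f ≤ w.normalized I f := fun w hw =>
    hS.le_normalized hI (hT.1 w hw) hf fun u hu => by
      by_cases huv : u = v
      · rw [huv]
      · exact (hlt u hu huv).le
  have hdom : ∀ g, g ≠ 0 → ∀ᶠ k : ℕ in atTop, ∀ u ∈ S,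
      v.normalized I (g * f ^ k) ≤ u.normalized I (g * f ^ k) := by
    -- Multiplying by a high power of `f` makes `v` the smallest member of `S`, hence a lower bound
    -- for all divisorial valuations.
    intro g hg
    refine (eventually_all_finite hSfin).2 fun u hu => ?_
    by_cases huv : u = v
    · simp [huv]
    have hpos := sub_pos.2 (hlt u hu huv)
    filter_upwards [(tendsto_natCast_atTop_atTop.atTop_mul_const hpos).eventually_ge_atTop
      (v.normalized I g - u.normalized I g)] with k hk
    rw [hexp _ _ hg, hexp _ _ hg]
    linarith [mul_sub (k : ℝ) (u.normalized I f) (v.normalized I f)]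
  have hdom' : ∀ g, g ≠ 0 → ∀ᶠ k : ℕ in atTop, ∀ w ∈ T,
      v.normalized I (g * f ^ k) ≤ w.normalized I (g * f ^ k) := fun g hg =>
    (hdom g hg).mono fun k hk w hw =>
      hS.le_normalized hI (hT.1 w hw) (mul_ne_zero hg (pow_ne_zero _ hf)) hk
  obtain ⟨w, hw, hwv⟩ := exists_isEquiv_of_forall_exists
    (T := {w ∈ T | w.normalized I f = v.normalized I f}) hI (hTfin.subset fun _ h => h.1)
    (fun w hw => hT.1 w hw.1) hvd
    (fun w hw g hg => by
      obtain ⟨k, hk⟩ := (hdom' g hg).exists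
      have := hk w hw.1
      rw [hexp _ _ hg, hexp _ _ hg, hw.2] at this
      linarith)
    (fun g hg => by
      -- Pigeonhole: `T` is finite and its minimum at `g * f ^ k` equals the value of `v` for all
      -- large `k`. Agreement of `w` and `v` at two exponents then gives agreement at `f` and at
      -- `g`.
      have hfreq : ∃ w ∈ T, ∃ᶠ k : ℕ in atTop,
          w.normalized I (g * f ^ k) = v.normalized I (g * f ^ k) := by
        by_contra! hcon
        have h1 := (eventually_all_finite hTfin).2 hcon
        obtain ⟨k, hk, hk'⟩ := (h1.and (hdom' g hg)).exists
        obtain ⟨w, hw, hle⟩ := hT.exists_normalized_le hTfin hI hvd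
          (mul_ne_zero hg (pow_ne_zero k hf))
        exact hk w hw (le_antisymm hle (hk' w hw))
      obtain ⟨w, hw, hk⟩ := hfreq
      obtain ⟨k, hk1⟩ := hk.exists
      obtain ⟨l, hl, hkl⟩ := frequently_atTop.1 hk (k + 1)
      rw [hexp _ _ hg, hexp _ _ hg] at hk1 hkl
      have hlk : (k : ℝ) < l := by exact_mod_cast hl
      have h2 : ((l : ℝ) - k) * (w.normalized I f - v.normalized I f) = 0 := by
        linear_combination hkl - hk1
      have h3 : w.normalized I f = v.normalized I f :=
        sub_eq_zero.1 ((mul_eq_zero.1 h2).resolve_left (sub_pos.2 hlk).ne')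
      rw [h3] at hk1
      exact ⟨w, ⟨hw, h3⟩, by linarith⟩)
  exact ⟨w, hw.1, hwv⟩

/-- Every finite computing set contains a computing set of Rees valuations. -/
theorem exists_subset_reesValuations (hS : ComputesIntegralClosures I S) (hfin : S.Finite)
    (hI : IsMPrimary I) : ∃ T ⊆ S, T ⊆ reesValuations I ∧ ComputesIntegralClosures I T := by
  obtain ⟨T, hTS, hT⟩ := (hfin.finite_subsets.subset (t :=
    {T | T ⊆ S ∧ ComputesIntegralClosures I T}) fun _ h => h.1).exists_le_minimal
      ⟨subset_rfl, hS⟩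
  refine ⟨T, hTS, fun v hv => ⟨hT.prop.2.1 v hv, fun S' hS' hc => ?_⟩, hT.prop.2⟩
  refine hT.prop.2.exists_isEquiv (hfin.subset hTS) hc hS' hI hv fun h => ?_
  exact (hT.le_of_le ⟨Set.sdiff_subset.trans hTS, h⟩ Set.sdiff_subset hv).2 rfl

end ComputesIntegralClosures

/-- A lower bound on the Rees valuations holds for all divisorial valuations. -/
theorem le_of_forall_mem_reesValuations (hI : IsMPrimary I) {t : ℝ} {f : R}
    (h : ∀ v ∈ reesValuations I, ENNReal.ofReal t * v.onIdeal I ≤ v f)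
    {w : RealValuation R} (hw : w.IsDivisorial) : ENNReal.ofReal t * w.onIdeal I ≤ w f := by
  by_cases hwR : w ∈ reesValuations I
  · exact h w hwR
  by_cases hf : f = 0
  · rw [hf, w.map_zero]; exact le_top
  -- Without a finite computing set, every divisorial valuation would vacuously be Rees, including
  -- `w`.
  have hex : ∃ S : Set (RealValuation R), S.Finite ∧ ComputesIntegralClosures I S := by
    by_contra! hcon
    exact hwR ⟨hw, fun S hS hc => absurd hc (hcon S hS)⟩
  obtain ⟨S, hfin, hS⟩ := hex
  obtain ⟨T, -, hTR, hT⟩ := hS.exists_subset_reesValuations hfin hI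
  rw [← le_normalized_iff (w.onIdeal_ne_zero hI) (hw.onIdeal_ne_top hI) hf]
  refine hT.le_normalized hI hw hf fun v hv => ?_
  rw [le_normalized_iff (v.onIdeal_ne_zero hI) ((hT.1 v hv).onIdeal_ne_top hI) hf]
  exact h v (hTR hv)

end ReesValuations

theorem proposition2 {R : Type*} [CommRing R] [IsDomain R] [IsLocalRing R] [IsNoetherianRing R]
    (hR : IsDomain (AdicCompletion (maximalIdeal R) R))
    (𝔞 : Ideal R) (h𝔞 : IsMPrimary 𝔞) (t : ℝ) (ht : 0 < t) :
    (adicFiltration 𝔞 h𝔞).saturation t =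
      maximalIdeal R ⊓ ⨅ v ∈ reesValuations 𝔞, v.scaledIdeal (v.onIdeal 𝔞) t := by
  ext f
  have hsat : f ∈ (adicFiltration 𝔞 h𝔞).saturation t ↔ f ∈ maximalIdeal R ∧
      ∀ v : RealValuation R, v.IsDivisorial → ENNReal.ofReal t * v.onIdeal 𝔞 ≤ v f := by
    simp only [← RealValuation.onFiltration_adicFiltration _ h𝔞]
    rfl
  simp only [hsat, Submodule.mem_inf, Submodule.mem_iInf, RealValuation.mem_scaledIdeal]
  exact and_congr_right fun _ => ⟨fun h v hv => h v hv.1,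
    fun h w hw => le_of_forall_mem_reesValuations h𝔞 h hw⟩
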